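/- Let $q$ be a complex number with $0<|q|<1$, and write $(x;q)_n=\prod_{i=0}^{n-1}(1-q^i x)$, $(x;q)_\infty=\prod_{i\ge 0}(1-q^i x)$ and $(q)_\infty=(q;q)_\infty$. Let $$\psi(q)=\sum_{n\ge 1}\frac{q^{n^2}}{(q;q^2)_n},\qquad \nu(q)=\sum_{n\ge 0}\frac{q^{n(n+1)}}{(-q;q^2)_{n+1}}$$ be the third order mock theta functions. Then $$1+2\psi(q)=\frac{1}{(q)_\infty}\sum_{n=0}^{\infty}(-1)^n q^{2n^2+n}\,(1+q^{2n+1})\sum_{j=-n}^{n}q^{-j(j+1)/2},$$ $$\nu(-q)=\frac{1}{(q)_\infty}\sum_{n=0}^{\infty}(-1)^n q^{2n^2+2n}\sum_{j=-n}^{n}q^{-j(j+1)/2},$$ where all the infinite series and the infinite product converge absolutely, $(q)_\infty\ne 0$, and no denominator vanishes. -/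

import Mathlib

noncomputable section

/-- The finite `q`-Pochhammer symbol `(x; q)_n = ∏_{i=0}^{n-1} (1 - q^i x)`. -/
def qPoch (x q : ℂ) (n : ℕ) : ℂ := ∏ i ∈ Finset.range n, (1 - q ^ i * x)

/-- The infinite `q`-Pochhammer symbol `(x; q)_∞ = ∏_{i ≥ 0} (1 - q^i x)`. -/
def qPochInf (x q : ℂ) : ℂ := ∏' i : ℕ, (1 - q ^ i * x)

/-- The `n`-th Eulerian term `q^{n^2} / (q; q^2)_n` of `ψ(q)`. -/
def psiTerm (q : ℂ) (n : ℕ) : ℂ := q ^ (n ^ 2) / qPoch q (q ^ 2) n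

/-- The third order mock theta function `ψ(q) = ∑_{n ≥ 1} q^{n^2} / (q; q^2)_n`. -/
def mockPsi (q : ℂ) : ℂ := ∑' n : ℕ, psiTerm q (n + 1)

/-- The `n`-th Eulerian term `q^{n(n+1)} / (-q; q^2)_{n+1}` of `ν(q)`. -/
def nuTerm (q : ℂ) (n : ℕ) : ℂ := q ^ (n * (n + 1)) / qPoch (-q) (q ^ 2) (n + 1)

/-- The third order mock theta function `ν(q) = ∑_{n ≥ 0} q^{n(n+1)} / (-q; q^2)_{n+1}`. -/
def mockNu (q : ℂ) : ℂ := ∑' n : ℕ, nuTerm q n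

/-- The inner sum `∑_{j=-n}^{n} q^{-j(j+1)/2}`; the integer division is exact. -/
def innerSum (q : ℂ) (n : ℕ) : ℂ :=
  ∑ j ∈ Finset.Icc (-(n : ℤ)) (n : ℤ), q ^ (-(j * (j + 1) / 2))

end

/-! The Bailey method. With c_r = (-1)^r q^(r^2+r) ∑_{|j|≤r} q^(-j(j+1)/2), `sum_heckeCoeff_nu`
expands 1/(q;q^2)_{n+1} as a finite sum of c_r / ((q)_{n-r} (q)_{n+r+1}); `sum_heckeCoeff_psi` is
the analogue for 2/(q;q^2)_n. Multiply by q^(n^2+n), respectively q^(n^2), sum over n, and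
interchange the sums. With m = n - r, the sum over m is an instance of Cauchy's identity
(`tsum_cauchyTerm`), whose value 1/(q)_∞ does not depend on r; what remains is the Hecke-type sum
over r. -/

theorem qPoch_succ (x q : ℂ) (n : ℕ) : qPoch x q (n + 1) = qPoch x q n * (1 - q ^ n * x) :=
  Finset.prod_range_succ _ _

theorem one_sub_pow_succ_ne_zero {q : ℂ} (hq1 : ‖q‖ < 1) (n : ℕ) : 1 - q ^ (n + 1) ≠ 0 := by
  intro h
  have h1 : ‖q ^ (n + 1)‖ = 1 := by rw [← sub_eq_zero.mp h, norm_one]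
  rw [norm_pow] at h1
  exact (pow_lt_one₀ (norm_nonneg q) hq1 n.succ_ne_zero).ne h1

theorem qPoch_self_ne_zero {q : ℂ} (hq1 : ‖q‖ < 1) (n : ℕ) : qPoch q q n ≠ 0 :=
  Finset.prod_ne_zero_iff.mpr fun i _ => by
    rw [← pow_succ]; exact one_sub_pow_succ_ne_zero hq1 i

theorem qPoch_sq_ne_zero {q : ℂ} (hq1 : ‖q‖ < 1) (n : ℕ) : qPoch q (q ^ 2) n ≠ 0 :=
  Finset.prod_ne_zero_iff.mpr fun i _ => by
    rw [← pow_mul, ← pow_succ]; exact one_sub_pow_succ_ne_zero hq1 (2 * i)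

/-! ### Triangular powers and the inner sum. -/

/-- The power `q ^ (r (r + 1) / 2)`, as a product. -/
noncomputable def triPow (q : ℂ) (r : ℕ) : ℂ := ∏ i ∈ Finset.range r, q ^ (i + 1)

theorem triPow_succ (q : ℂ) (r : ℕ) : triPow q (r + 1) = triPow q r * q ^ (r + 1) :=
  Finset.prod_range_succ _ _

theorem triPow_ne_zero {q : ℂ} (hq0 : q ≠ 0) (r : ℕ) : triPow q r ≠ 0 :=
  Finset.prod_ne_zero_iff.mpr fun _ _ => pow_ne_zero _ hq0

theorem triPow_sq (q : ℂ) (r : ℕ) : triPow q r ^ 2 = q ^ (r ^ 2 + r) := by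
  induction r with
  | zero => simp [triPow]
  | succ r ih => rw [triPow_succ, mul_pow, ih]; ring

theorem zpow_triangular {q : ℂ} (hq0 : q ≠ 0) (r : ℕ) :
    q ^ (-((r : ℤ) * (r + 1) / 2)) = 1 / triPow q r := by
  induction r with
  | zero => simp [triPow]
  | succ r ih =>
    have h : (((r + 1 : ℕ) : ℤ) * ((r + 1 : ℕ) + 1) / 2) = (r : ℤ) * (r + 1) / 2 + (r + 1 : ℕ) := by
      rw [← Int.add_mul_ediv_right _ _ (by norm_num : (2 : ℤ) ≠ 0)]
      congr 1; push_cast; ring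
    rw [h, neg_add, zpow_add₀ hq0, ih, triPow_succ, zpow_neg, zpow_natCast]
    field_simp

theorem innerSum_zero (q : ℂ) : innerSum q 0 = 1 := by simp [innerSum]

/-- The new indices j = -(r+1) and j = r+1 contribute the triangular numbers of r and r+1. -/
theorem innerSum_succ {q : ℂ} (hq0 : q ≠ 0) (r : ℕ) :
    innerSum q (r + 1) = innerSum q r + 1 / triPow q r + 1 / triPow q (r + 1) := by
  have h : Finset.Icc (-((r + 1 : ℕ) : ℤ)) ((r + 1 : ℕ) : ℤ)
      = insert (-((r : ℤ) + 1)) (insert ((r : ℤ) + 1) (Finset.Icc (-(r : ℤ)) r)) := by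
    ext x; simp only [Finset.mem_Icc, Finset.mem_insert]; omega
  rw [innerSum, h, Finset.sum_insert (by simp only [Finset.mem_Icc, Finset.mem_insert]; omega),
    Finset.sum_insert (by simp), ← zpow_triangular hq0, ← zpow_triangular hq0, innerSum]
  have h2 : -((r : ℤ) + 1) * (-((r : ℤ) + 1) + 1) = (r : ℤ) * (r + 1) := by ring
  rw [h2]; push_cast; ring

/-! ### The two finite Bailey pairs. -/

/-- The coefficient `(-1)^r q^{r^2+r} ∑_{j=-r}^{r} q^{-j(j+1)/2}` of the Bailey pair. -/
noncomputable def heckeCoeff (q : ℂ) (r : ℕ) : ℂ := (-1) ^ r * q ^ (r ^ 2 + r) * innerSum q r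

/-- The antidifference certifying the recurrence of the Bailey pair, in `r` for fixed `n`. -/
noncomputable def heckeCert (q : ℂ) (n r : ℕ) : ℂ :=
  (-1) ^ r * triPow q r ^ 2 * q ^ (n - r) / (qPoch q q (n - r) * qPoch q q (n + r)) *
    (-innerSum q r + 1 / triPow q r * (q ^ r - q ^ n) / (1 - q ^ n))

theorem heckeCert_zero {q : ℂ} (hq1 : ‖q‖ < 1) (n : ℕ) : heckeCert q (n + 1) 0 = 0 := by
  have := one_sub_pow_succ_ne_zero hq1 n
  simp [heckeCert, innerSum_zero, triPow, this]

/-- Writing n = r+m+1 removes truncated subtraction. The recurrence of `innerSum` then leaves a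
rational identity in which q^r, q^m, the inner sum, the triangular power and the two Pochhammer
symbols are free variables. -/
theorem heckeCert_sub {q : ℂ} (hq0 : q ≠ 0) (hq1 : ‖q‖ < 1) (r m : ℕ) :
    (1 - q ^ (2 * (r + m + 1) + 1)) *
        (heckeCoeff q r / (qPoch q q (m + 1) * qPoch q q (r + m + 1 + r + 1))) -
      heckeCoeff q r / (qPoch q q m * qPoch q q (r + m + r + 1)) =
    heckeCert q (r + m + 1) (r + 1) - heckeCert q (r + m + 1) r := by
  have e1 : r + m + 1 - r = m + 1 := by omega
  have e2 : r + m + 1 - (r + 1) = m := by omega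
  have e3 : r + m + 1 + r + 1 = r + m + r + 1 + 1 := by omega
  have e4 : r + m + 1 + r = r + m + r + 1 := by omega
  have e5 : r + m + 1 + (r + 1) = r + m + r + 1 + 1 := by omega
  rw [heckeCoeff, heckeCert, heckeCert, e1, e2, e3, e4, e5, innerSum_succ hq0, triPow_succ,
    qPoch_succ q q m, qPoch_succ q q (r + m + r + 1), ← triPow_sq]
  have h1 := qPoch_self_ne_zero hq1 m
  have h2 := qPoch_self_ne_zero hq1 (r + m + r + 1)
  have h3 := triPow_ne_zero hq0 r
  have h4 := one_sub_pow_succ_ne_zero hq1 m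
  have h5 := one_sub_pow_succ_ne_zero hq1 (r + m)
  have h6 := one_sub_pow_succ_ne_zero hq1 (r + m + r + 1)
  generalize qPoch q q m = A at *
  generalize qPoch q q (r + m + r + 1) = B at *
  generalize triPow q r = T at *
  generalize innerSum q r = S at *
  have hx : q ^ r ≠ 0 := pow_ne_zero _ hq0
  simp only [pow_add, pow_mul', pow_one] at *
  generalize q ^ r = x at *
  generalize q ^ m = y at *
  have h7 : 1 - x ^ 2 * y * q ^ 2 ≠ 0 := by convert h6 using 1; ring
  field_simp
  ring

/-- The Bailey pair behind `ν`: `∑_r c_r / ((q)_{n-r} (q)_{n+r+1}) = 1 / (q; q^2)_{n+1}`. -/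
theorem sum_heckeCoeff_nu {q : ℂ} (hq0 : q ≠ 0) (hq1 : ‖q‖ < 1) (n : ℕ) :
    ∑ r ∈ Finset.range (n + 1), heckeCoeff q r / (qPoch q q (n - r) * qPoch q q (n + r + 1)) =
      1 / qPoch q (q ^ 2) (n + 1) := by
  induction n with
  | zero => simp [heckeCoeff, innerSum_zero, qPoch]
  | succ n ih =>
    have key : (1 - q ^ (2 * (n + 1) + 1)) *
        ∑ r ∈ Finset.range (n + 1 + 1),
          heckeCoeff q r / (qPoch q q (n + 1 - r) * qPoch q q (n + 1 + r + 1)) -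
        ∑ r ∈ Finset.range (n + 1), heckeCoeff q r / (qPoch q q (n - r) * qPoch q q (n + r + 1))
        = 0 := by
      -- The terms r ≤ n telescope to the certificate at r = n+1, which cancels the remaining term r
      -- = n+1.
      have hs := Finset.sum_range_sub (heckeCert q (n + 1)) (n + 1)
      rw [heckeCert_zero hq1, sub_zero] at hs
      rw [Finset.mul_sum, Finset.sum_range_succ, add_sub_right_comm, ← Finset.sum_sub_distrib,
        Finset.sum_congr rfl (g := fun r => heckeCert q (n + 1) (r + 1) - heckeCert q (n + 1) r),
        hs]
      · have h2 := qPoch_self_ne_zero hq1 (n + 1 + (n + 1))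
        have h6 := one_sub_pow_succ_ne_zero hq1 (2 * (n + 1))
        rw [heckeCert, heckeCoeff, qPoch_succ q q (n + 1 + (n + 1)), ← pow_succ, ← two_mul,
          ← triPow_sq]
        rw [← two_mul] at h2
        have h0 : qPoch q q 0 = 1 := by simp [qPoch]
        simp only [Nat.sub_self, sub_self, mul_zero, zero_div, add_zero, pow_zero, h0]
        generalize qPoch q q (2 * (n + 1)) = A at *
        field_simp
        ring
      · intro r hr
        obtain ⟨m, rfl⟩ := Nat.exists_eq_add_of_le (Nat.lt_succ_iff.mp (Finset.mem_range.mp hr))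
        have e1 : r + m + 1 - r = m + 1 := by omega
        have e2 : r + m - r = m := by omega
        simpa only [e1, e2] using heckeCert_sub hq0 hq1 r m
    rw [ih] at key
    have h6 := one_sub_pow_succ_ne_zero hq1 (2 * (n + 1))
    have h7 := qPoch_sq_ne_zero hq1 (n + 1)
    rw [qPoch_succ q (q ^ 2) (n + 1), ← pow_mul, ← pow_succ]
    rw [sub_eq_zero] at key
    field_simp at key ⊢
    linear_combination key

/-- The Bailey pair behind `ψ`. -/
theorem sum_heckeCoeff_psi {q : ℂ} (hq0 : q ≠ 0) (hq1 : ‖q‖ < 1) (n : ℕ) :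
    ∑ r ∈ Finset.range (n + 1 + 1), heckeCoeff q r *
        ((1 - q ^ (n + 1 + r + 1)) + (1 - q ^ (n + 1 - r))) /
          (qPoch q q (n + 1 - r) * qPoch q q (n + 1 + r + 1)) =
      2 / qPoch q (q ^ 2) (n + 1) := by
  -- With N = n+1, a = q^(N+r+1), b = q^(N-r), one has ab = q^(2N+1) and (1-ab) + (1-a)(1-b) = (1-a)
  -- + (1-b). So the ν pair at N, times 1 - q^(2N+1), is added to the ν pair at N-1.
  have h1 := sum_heckeCoeff_nu hq0 hq1 n
  have h2 := sum_heckeCoeff_nu hq0 hq1 (n + 1)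
  have h6 := one_sub_pow_succ_ne_zero hq1 (2 * (n + 1))
  have h7 := qPoch_sq_ne_zero hq1 (n + 1)
  have h3 : (1 - q ^ (2 * (n + 1) + 1)) * (1 / qPoch q (q ^ 2) (n + 1 + 1))
      + 1 / qPoch q (q ^ 2) (n + 1) = 2 / qPoch q (q ^ 2) (n + 1) := by
    rw [qPoch_succ q (q ^ 2) (n + 1), ← pow_mul, ← pow_succ]
    field_simp
    ring
  rw [← h3, ← h1, ← h2, Finset.mul_sum, Finset.sum_range_succ _ (n + 1),
    Finset.sum_range_succ _ (n + 1), add_right_comm (Finset.sum _ _), ← Finset.sum_add_distrib]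
  congr 1
  · refine Finset.sum_congr rfl fun r hr => ?_
    obtain ⟨m, rfl⟩ := Nat.exists_eq_add_of_le (Nat.lt_succ_iff.mp (Finset.mem_range.mp hr))
    have e1 : r + m + 1 - r = m + 1 := by omega
    have e2 : r + m - r = m := by omega
    have e3 : r + m + 1 + r + 1 = r + m + r + 1 + 1 := by omega
    rw [e1, e2, e3, qPoch_succ q q m, qPoch_succ q q (r + m + r + 1), ← pow_succ, ← pow_succ]
    have h1 := qPoch_self_ne_zero hq1 m
    have h2 := qPoch_self_ne_zero hq1 (r + m + r + 1)
    have h4 := one_sub_pow_succ_ne_zero hq1 m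
    have h5 := one_sub_pow_succ_ne_zero hq1 (r + m + r + 1)
    field_simp
    ring
  · simp only [Nat.sub_self, pow_zero, sub_self, add_zero]
    rw [show n + 1 + (n + 1) + 1 = 2 * (n + 1) + 1 by ring]
    ring

/-! ### The infinite product and bounds on its partial inverses. -/

open Filter Topology

theorem summable_norm_qPoch_factor {q : ℂ} (hq1 : ‖q‖ < 1) :
    Summable fun i : ℕ => ‖-(q ^ i * q)‖ := by
  simp only [norm_neg, norm_mul, norm_pow]
  exact (summable_geometric_of_lt_one (norm_nonneg q) hq1).mul_right _

theorem multipliable_qPoch_self {q : ℂ} (hq1 : ‖q‖ < 1) :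
    Multipliable fun i : ℕ => 1 - q ^ i * q := by
  simpa only [sub_eq_add_neg] using
    multipliable_one_add_of_summable (summable_norm_qPoch_factor hq1)

theorem qPochInf_self_ne_zero {q : ℂ} (hq1 : ‖q‖ < 1) : qPochInf q q ≠ 0 := by
  have := tprod_one_add_ne_zero_of_summable (f := fun i : ℕ => -(q ^ i * q)) (fun i => by
    rw [← sub_eq_add_neg, ← pow_succ]; exact one_sub_pow_succ_ne_zero hq1 i)
    (summable_norm_qPoch_factor hq1)
  simpa only [qPochInf, sub_eq_add_neg] using this

theorem tendsto_inv_qPoch_self {q : ℂ} (hq1 : ‖q‖ < 1) :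
    Tendsto (fun n => (qPoch q q n)⁻¹) atTop (𝓝 (qPochInf q q)⁻¹) :=
  ((multipliable_qPoch_self hq1).hasProd.tendsto_prod_nat).inv₀ (qPochInf_self_ne_zero hq1)

theorem exists_norm_inv_qPoch_self_le {q : ℂ} (hq1 : ‖q‖ < 1) :
    ∃ K : ℝ, 0 ≤ K ∧ ∀ n, ‖(qPoch q q n)⁻¹‖ ≤ K := by
  obtain ⟨K, hK⟩ := (Metric.isBounded_range_of_tendsto _
    (tendsto_inv_qPoch_self hq1)).exists_norm_le
  exact ⟨K, (norm_nonneg _).trans (hK _ ⟨0, rfl⟩), fun n => hK _ ⟨n, rfl⟩⟩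

/-! ### Cauchy's identity. -/

/-- The summand of Cauchy's identity `∑_m q^{m^2+mk} / ((q)_m (q)_{m+k}) = 1 / (q)_∞`. -/
noncomputable def cauchyTerm (q : ℂ) (k m : ℕ) : ℂ :=
  q ^ (m ^ 2 + m * k) * (qPoch q q m)⁻¹ * (qPoch q q (m + k))⁻¹

theorem HasSum.congr_right {ι : Type*} {f : ι → ℂ} {a b : ℂ} (hf : HasSum f a) (h : b = a) :
    HasSum f b :=
  h ▸ hf

theorem norm_pow_mul_inv_mul_inv_le {q : ℂ} {K : ℝ} (hq1 : ‖q‖ < 1)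
    (hK : ∀ n, ‖(qPoch q q n)⁻¹‖ ≤ K) {a b : ℕ} (hab : b ≤ a) (m n : ℕ) :
    ‖q ^ a * (qPoch q q m)⁻¹ * (qPoch q q n)⁻¹‖ ≤ ‖q‖ ^ b * K * K := by
  have hK0 : 0 ≤ K := (norm_nonneg _).trans (hK 0)
  rw [norm_mul, norm_mul, norm_pow]
  have h := pow_le_pow_of_le_one (norm_nonneg q) hq1.le hab
  exact mul_le_mul (mul_le_mul h (hK m) (norm_nonneg _) (by positivity)) (hK n) (norm_nonneg _)
    (by positivity)

theorem summable_pow_mul_const {q : ℂ} (hq1 : ‖q‖ < 1) (K : ℝ) :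
    Summable fun m : ℕ => ‖q‖ ^ m * K * K :=
  ((summable_geometric_of_lt_one (norm_nonneg q) hq1).mul_right K).mul_right K

theorem le_sq_add_mul (m k : ℕ) : m ≤ m ^ 2 + m * k := by nlinarith [Nat.le_self_pow two_ne_zero m]

theorem summable_cauchyTerm {q : ℂ} (hq1 : ‖q‖ < 1) (k : ℕ) : Summable (cauchyTerm q k) := by
  obtain ⟨K, -, hK⟩ := exists_norm_inv_qPoch_self_le hq1
  exact .of_norm_bounded (summable_pow_mul_const hq1 K) fun m =>
    norm_pow_mul_inv_mul_inv_le hq1 hK (le_sq_add_mul m k) _ _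

/-- As k grows, only the term m = 0 survives. -/
theorem tendsto_tsum_cauchyTerm {q : ℂ} (hq1 : ‖q‖ < 1) :
    Tendsto (fun k => ∑' m, cauchyTerm q k m) atTop (𝓝 (qPochInf q q)⁻¹) := by
  obtain ⟨K, hK0, hK⟩ := exists_norm_inv_qPoch_self_le hq1
  have h : ∑' m : ℕ, (if m = 0 then (qPochInf q q)⁻¹ else 0) = (qPochInf q q)⁻¹ :=
    tsum_ite_eq 0 _
  rw [← h]
  refine tendsto_tsum_of_dominated_convergence (summable_pow_mul_const hq1 K) (fun m => ?_)
    (Eventually.of_forall fun k m => norm_pow_mul_inv_mul_inv_le hq1 hK (le_sq_add_mul m k) _ _)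
  rcases Nat.eq_zero_or_pos m with rfl | hm
  · simpa [cauchyTerm, qPoch] using tendsto_inv_qPoch_self hq1
  · rw [if_neg hm.ne']
    refine squeeze_zero_norm (a := fun k => ‖q‖ ^ k * K * K) (fun k =>
      norm_pow_mul_inv_mul_inv_le hq1 hK (by nlinarith) _ _) ?_
    simpa using ((tendsto_pow_atTop_nhds_zero_of_lt_one (norm_nonneg q) hq1).mul_const K).mul_const K

/-- The shifted series obtained by cancelling the factor `1 - q^m` of `(q)_m`. -/
theorem hasSum_cauchyTerm_shift {q : ℂ} (hq1 : ‖q‖ < 1) (k : ℕ) :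
    HasSum (fun m => q ^ (m ^ 2 + m * k) * (1 - q ^ m) * (qPoch q q m)⁻¹ *
      (qPoch q q (m + k + 1))⁻¹) (q ^ (k + 1) * ∑' m, cauchyTerm q (k + 2) m) := by
  rw [← hasSum_nat_add_iff' 1]
  simp only [Finset.sum_range_one, pow_zero, sub_self, mul_zero, zero_mul, sub_zero]
  refine ((summable_cauchyTerm hq1 (k + 2)).hasSum.mul_left (q ^ (k + 1))).congr_fun fun m => ?_
  have h := one_sub_pow_succ_ne_zero hq1 m
  rw [cauchyTerm, qPoch_succ, ← pow_succ, mul_inv, show m + 1 + k + 1 = m + (k + 2) by ring,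
    show (m + 1) ^ 2 + (m + 1) * k = (k + 1) + (m ^ 2 + m * (k + 2)) by ring, pow_add]
  field_simp

/-- Termwise, 1 - q^(m+k+1) - q^m = (1 - q^m) - q^(k+1) q^m; the first part sums by the shifted
series. -/
theorem tsum_cauchyTerm_sub {q : ℂ} (hq1 : ‖q‖ < 1) (k : ℕ) :
    ∑' m, cauchyTerm q k m - ∑' m, cauchyTerm q (k + 1) m =
      -q ^ (k + 1) * (∑' m, cauchyTerm q (k + 1) m - ∑' m, cauchyTerm q (k + 2) m) := by
  have h0 := (summable_cauchyTerm hq1 k).hasSum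
  have h1 := (summable_cauchyTerm hq1 (k + 1)).hasSum
  have h2 := (hasSum_cauchyTerm_shift hq1 k).sub (h1.mul_left (q ^ (k + 1)))
  have h3 := (h0.sub h1).unique (h2.congr_fun ?_)
  · rw [h3]; ring
  · intro m
    have h := one_sub_pow_succ_ne_zero hq1 (m + k)
    have h' := qPoch_self_ne_zero hq1 (m + k)
    simp only [cauchyTerm]
    rw [← add_assoc m k 1, qPoch_succ q q (m + k), ← pow_succ]
    field_simp
    ring

/-- Consecutive differences do not decrease in norm as k grows, since |q^(k+1)| ≤ 1, yet they tend
to 0 because the sums converge. Hence they all vanish. -/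
theorem tsum_cauchyTerm_eq_succ {q : ℂ} (hq1 : ‖q‖ < 1) (k : ℕ) :
    ∑' m, cauchyTerm q k m = ∑' m, cauchyTerm q (k + 1) m := by
  have ht := tendsto_tsum_cauchyTerm hq1
  have hd : Tendsto (fun j => ‖∑' m, cauchyTerm q (k + j) m - ∑' m, cauchyTerm q (k + j + 1) m‖)
      atTop (𝓝 0) := by
    have h1 := ht.comp (tendsto_add_atTop_nat k)
    have h2 := ht.comp (tendsto_add_atTop_nat (k + 1))
    simpa [Function.comp_def, add_comm, add_left_comm, add_assoc] using (h1.sub h2).norm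
  have hb : ∀ j, ‖∑' m, cauchyTerm q k m - ∑' m, cauchyTerm q (k + 1) m‖ ≤
      ‖∑' m, cauchyTerm q (k + j) m - ∑' m, cauchyTerm q (k + j + 1) m‖ := by
    intro j
    induction j with
    | zero => rfl
    | succ j ih =>
      refine ih.trans ?_
      rw [tsum_cauchyTerm_sub hq1, norm_mul, norm_neg, norm_pow]
      exact mul_le_of_le_one_left (norm_nonneg _) (pow_le_one₀ (norm_nonneg _) hq1.le)
  exact sub_eq_zero.mp (norm_le_zero_iff.mp (ge_of_tendsto' hd hb))

/-- Cauchy's identity. -/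
theorem tsum_cauchyTerm {q : ℂ} (hq1 : ‖q‖ < 1) (k : ℕ) :
    ∑' m, cauchyTerm q k m = (qPochInf q q)⁻¹ := by
  have h : ∀ j, ∑' m, cauchyTerm q (j + k) m = ∑' m, cauchyTerm q k m := by
    intro j
    induction j with
    | zero => rw [zero_add]
    | succ j ih => rw [← ih, add_right_comm, ← tsum_cauchyTerm_eq_succ hq1]
  have ht := (tendsto_tsum_cauchyTerm hq1).comp (tendsto_add_atTop_nat k)
  simp only [Function.comp_def, h] at ht
  exact tendsto_nhds_unique tendsto_const_nhds ht

theorem hasSum_cauchyTerm {q : ℂ} (hq1 : ‖q‖ < 1) (k : ℕ) :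
    HasSum (cauchyTerm q k) (qPochInf q q)⁻¹ :=
  tsum_cauchyTerm hq1 k ▸ (summable_cauchyTerm hq1 k).hasSum

/-! ### Interchange of summation. -/

/-- Evaluate a double series by rows and by antidiagonals. -/
theorem hasSum_antidiagonal_and_rows {F : ℕ → ℕ → ℂ} {a b : ℕ → ℂ}
    (hF : Summable fun p : ℕ × ℕ => F p.1 p.2) (ha : ∀ r, HasSum (F r) (a r))
    (hb : ∀ n, ∑ r ∈ Finset.range (n + 1), F r (n - r) = b n) :
    Summable a ∧ HasSum b (∑' r, a r) := by
  have h1 := hF.hasSum.prod_fiberwise ha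
  refine ⟨h1.summable, ?_⟩
  rw [h1.tsum_eq]
  have h2 := (Finset.HasAntidiagonal.sigmaAntidiagonalEquivProd (A := ℕ) |>.hasSum_iff.mpr hF.hasSum).sigma
    (g := b) fun n => by
      have := hasSum_fintype fun p : Finset.HasAntidiagonal.antidiagonal n => F p.1.1 p.1.2
      rw [Finset.univ_eq_attach, Finset.sum_attach _ fun p : ℕ × ℕ => F p.1 p.2,
        Finset.Nat.sum_antidiagonal_eq_sum_range_succ F, hb] at this
      exact this
  exact h2

/-- For |j| ≤ r, j(j+1)/2 ≤ r^2+r, so each of the 2r+1 terms is a nonnegative power of q. -/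
theorem norm_heckeCoeff_le {q : ℂ} (hq0 : q ≠ 0) (hq1 : ‖q‖ < 1) (r : ℕ) :
    ‖heckeCoeff q r‖ ≤ 2 * r + 1 := by
  have hs : ‖q ^ (r ^ 2 + r) * innerSum q r‖ ≤ 2 * r + 1 := by
    rw [innerSum, Finset.mul_sum]
    refine (norm_sum_le_of_le (n := fun _ => (1 : ℝ)) _ fun j hj => ?_).trans ?_
    · obtain ⟨h1, h2⟩ := Finset.mem_Icc.mp hj
      have h3 : 0 ≤ ((r ^ 2 + r : ℕ) : ℤ) + -(j * (j + 1) / 2) := by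
        have : j * (j + 1) / 2 ≤ (r : ℤ) ^ 2 + r :=
          Int.ediv_le_of_le_mul (by norm_num) (by nlinarith)
        push_cast; linarith
      obtain ⟨e, he⟩ := Int.eq_ofNat_of_zero_le h3
      rw [← zpow_natCast, ← zpow_add₀ hq0, he, zpow_natCast, norm_pow]
      exact pow_le_one₀ (norm_nonneg _) hq1.le
    · simp only [Finset.sum_const, Int.card_Icc, nsmul_eq_mul, mul_one]
      rw [show ((r : ℤ) + 1 - -(r : ℤ)).toNat = 2 * r + 1 by omega]
      push_cast; rfl
  rw [heckeCoeff, mul_assoc, norm_mul]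
  simpa using hs

theorem summable_heckeCoeff_bound {q : ℂ} (hq1 : ‖q‖ < 1) (K : ℝ) :
    Summable fun p : ℕ × ℕ => (2 * (p.1 : ℝ) + 1) * ‖q‖ ^ p.1 * (‖q‖ ^ p.2 * K * K) := by
  have h : Summable fun r : ℕ => (2 * (r : ℝ) + 1) * ‖q‖ ^ r := by
    have h1 := summable_pow_mul_geometric_of_norm_lt_one 1 (r := ‖q‖) (by simpa using hq1)
    have h2 := summable_geometric_of_lt_one (norm_nonneg q) hq1
    refine ((h1.mul_left 2).add h2).congr fun r => ?_
    ring
  refine h.mul_of_nonneg (summable_pow_mul_const hq1 K) (fun r => ?_) fun m => ?_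
  · positivity
  · have := mul_self_nonneg K
    have := pow_nonneg (norm_nonneg q) m
    change 0 ≤ _ * K * K
    rw [mul_assoc]; positivity

/-! ### The two Hecke-type identities. -/

theorem hecke_nu {q : ℂ} (hq0 : q ≠ 0) (hq1 : ‖q‖ < 1) :
    Summable (fun n : ℕ => (-1) ^ n * q ^ (2 * n ^ 2 + 2 * n) * innerSum q n) ∧
    HasSum (nuTerm (-q)) (1 / qPochInf q q *
      ∑' n : ℕ, (-1) ^ n * q ^ (2 * n ^ 2 + 2 * n) * innerSum q n) := by
  obtain ⟨K, hK0, hK⟩ := exists_norm_inv_qPoch_self_le hq1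
  have key := hasSum_antidiagonal_and_rows
    (F := fun r m => heckeCoeff q r * (q ^ ((m + r) ^ 2 + (m + r)) * (qPoch q q m)⁻¹ *
      (qPoch q q (m + 2 * r + 1))⁻¹))
    (a := fun n => (-1) ^ n * q ^ (2 * n ^ 2 + 2 * n) * innerSum q n * (qPochInf q q)⁻¹)
    (b := nuTerm (-q)) ?_ ?_ ?_
  · have hne := qPochInf_self_ne_zero hq1
    rw [tsum_mul_right, mul_comm, ← one_div] at key
    refine ⟨(key.1.mul_right (qPochInf q q)).congr fun n => ?_, key.2⟩
    field_simp
  · refine .of_norm_bounded (summable_heckeCoeff_bound hq1 K) fun ⟨r, m⟩ => ?_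
    have hc := norm_heckeCoeff_le hq0 hq1 r
    have h5 := norm_pow_mul_inv_mul_inv_le hq1 hK
      (Nat.le_add_left (m + r) ((m + r) ^ 2)) m (m + 2 * r + 1)
    rw [norm_mul]
    calc _ ≤ (2 * (r : ℝ) + 1) * (‖q‖ ^ (m + r) * K * K) := by gcongr
      _ = _ := by rw [pow_add]; ring
  · intro r
    have hA := (hasSum_cauchyTerm hq1 (2 * r + 1)).mul_left (heckeCoeff q r * q ^ (r ^ 2 + r))
    refine (hA.congr_fun fun m => ?_).congr_right ?_
    · rw [cauchyTerm, add_assoc m, show (m + r) ^ 2 + (m + r) =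
        (r ^ 2 + r) + (m ^ 2 + m * (2 * r + 1)) by ring, pow_add q (r ^ 2 + r)]
      ring
    · rw [heckeCoeff]; ring
  · intro n
    have hev : (-q) ^ (n * (n + 1)) = q ^ (n * (n + 1)) := (Nat.even_mul_succ_self n).neg_pow q
    rw [nuTerm, hev, neg_neg, neg_sq, div_eq_mul_one_div, ← sum_heckeCoeff_nu hq0 hq1,
      Finset.mul_sum]
    refine Finset.sum_congr rfl fun r hr => ?_
    obtain ⟨m, rfl⟩ := Nat.exists_eq_add_of_le (Nat.lt_succ_iff.mp (Finset.mem_range.mp hr))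
    rw [show r + m - r = m by omega, show r + m + r + 1 = m + 2 * r + 1 by ring,
      show (r + m) * (r + m + 1) = (m + r) ^ 2 + (m + r) by ring, div_eq_mul_inv, mul_inv]
    ring

theorem hecke_psi {q : ℂ} (hq0 : q ≠ 0) (hq1 : ‖q‖ < 1) :
    Summable (fun n : ℕ =>
      (-1) ^ n * q ^ (2 * n ^ 2 + n) * (1 + q ^ (2 * n + 1)) * innerSum q n) ∧
    HasSum (fun n => if n = 0 then 1 else 2 * psiTerm q n) (1 / qPochInf q q *
      ∑' n : ℕ, (-1) ^ n * q ^ (2 * n ^ 2 + n) * (1 + q ^ (2 * n + 1)) * innerSum q n) := by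
  obtain ⟨K, hK0, hK⟩ := exists_norm_inv_qPoch_self_le hq1
  have key := hasSum_antidiagonal_and_rows
    (F := fun r m => heckeCoeff q r * ((1 - q ^ (m + 2 * r + 1)) + (1 - q ^ m)) *
      (q ^ ((m + r) ^ 2) * (qPoch q q m)⁻¹ * (qPoch q q (m + 2 * r + 1))⁻¹))
    (a := fun n => (-1) ^ n * q ^ (2 * n ^ 2 + n) * (1 + q ^ (2 * n + 1)) * innerSum q n *
      (qPochInf q q)⁻¹)
    (b := fun n => if n = 0 then 1 else 2 * psiTerm q n) ?_ ?_ ?_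
  · have hne := qPochInf_self_ne_zero hq1
    rw [tsum_mul_right, mul_comm, ← one_div] at key
    refine ⟨(key.1.mul_right (qPochInf q q)).congr fun n => ?_, key.2⟩
    field_simp
  · refine .of_norm_bounded ((summable_heckeCoeff_bound hq1 K).mul_left 4) fun ⟨r, m⟩ => ?_
    have hp : ∀ j : ℕ, ‖1 - q ^ j‖ ≤ 2 := fun j => by
      refine (norm_sub_le _ _).trans ?_
      have := pow_le_one₀ (n := j) (norm_nonneg q) hq1.le
      rw [norm_one, norm_pow]; linarith
    have h4 : ‖(1 - q ^ (m + 2 * r + 1)) + (1 - q ^ m)‖ ≤ 4 :=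
      (norm_add_le _ _).trans (by linarith [hp (m + 2 * r + 1), hp m])
    have hc := norm_heckeCoeff_le hq0 hq1 r
    have h5 := norm_pow_mul_inv_mul_inv_le hq1 hK (Nat.le_self_pow two_ne_zero (m + r)) m
      (m + 2 * r + 1)
    rw [norm_mul, norm_mul]
    calc _ ≤ (2 * (r : ℝ) + 1) * 4 * (‖q‖ ^ (m + r) * K * K) := by gcongr
      _ = _ := by rw [pow_add]; ring
  · intro r
    have hA := (hasSum_cauchyTerm hq1 (2 * r)).mul_left (heckeCoeff q r * q ^ r ^ 2)
    -- The summand 1 - q^m yields an extra q^(2r+1), the source of the factor 1 + q^(2r+1).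
    have hB := (hasSum_cauchyTerm_shift hq1 (2 * r)).mul_left (heckeCoeff q r * q ^ r ^ 2)
    rw [tsum_cauchyTerm hq1] at hB
    refine ((hA.add hB).congr_fun fun m => ?_).congr_right ?_
    · have h := one_sub_pow_succ_ne_zero hq1 (m + 2 * r)
      rw [cauchyTerm, qPoch_succ q q (m + 2 * r), ← pow_succ, mul_inv,
        show (m + r) ^ 2 = r ^ 2 + (m ^ 2 + m * (2 * r)) by ring, pow_add q (r ^ 2)]
      field_simp
    · rw [heckeCoeff]; ring
  · rintro (_ | n)
    -- At n = 0 the factor 1 - q^(n-r) vanishes, so the value is 1 rather than 2: the leading 1 of 1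
    -- + 2ψ(q).
    · simp only [zero_add, Finset.sum_range_one, if_true]
      have h := one_sub_pow_succ_ne_zero hq1 0
      rw [zero_add, pow_one] at h
      simp [heckeCoeff, innerSum_zero, qPoch, h]
    · rw [if_neg n.succ_ne_zero, psiTerm, mul_div_left_comm, ← sum_heckeCoeff_psi hq0 hq1,
        Finset.mul_sum]
      refine Finset.sum_congr rfl fun r hr => ?_
      obtain ⟨m, hm⟩ := Nat.exists_eq_add_of_le (Nat.lt_succ_iff.mp (Finset.mem_range.mp hr))
      rw [hm, show r + m - r = m by omega, show r + m + r + 1 = m + 2 * r + 1 by ring,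
        add_comm r m, div_eq_mul_inv, mul_inv]
      ring

theorem theorem1p3 (q : ℂ) (hq0 : q ≠ 0) (hq1 : ‖q‖ < 1) :
    -- everything in the two identities is well defined
    (Multipliable (fun i : ℕ => 1 - q ^ i * q) ∧ qPochInf q q ≠ 0 ∧
      (∀ n : ℕ, qPoch q (q ^ 2) n ≠ 0) ∧
      Summable (fun n : ℕ => psiTerm q (n + 1)) ∧
      Summable (fun n : ℕ => nuTerm (-q) n) ∧
      Summable (fun n : ℕ =>
        (-1) ^ n * q ^ (2 * n ^ 2 + n) * (1 + q ^ (2 * n + 1)) * innerSum q n) ∧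
      Summable (fun n : ℕ => (-1) ^ n * q ^ (2 * n ^ 2 + 2 * n) * innerSum q n)) ∧
    -- the two Hecke-type double sum representations
    1 + 2 * mockPsi q =
      1 / qPochInf q q *
        ∑' n : ℕ, (-1) ^ n * q ^ (2 * n ^ 2 + n) * (1 + q ^ (2 * n + 1)) * innerSum q n ∧
    mockNu (-q) =
      1 / qPochInf q q *
        ∑' n : ℕ, (-1) ^ n * q ^ (2 * n ^ 2 + 2 * n) * innerSum q n := by
  obtain ⟨hs1, h1⟩ := hecke_psi hq0 hq1
  obtain ⟨hs2, h2⟩ := hecke_nu hq0 hq1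
  have h3 := (hasSum_nat_add_iff' 1).mpr h1
  simp only [Nat.add_eq_zero_iff, one_ne_zero, and_false, if_false, Finset.sum_range_one,
    if_true] at h3
  have h4 : Summable fun n : ℕ => psiTerm q (n + 1) :=
    (summable_mul_left_iff (two_ne_zero' ℂ)).mp h3.summable
  refine ⟨⟨multipliable_qPoch_self hq1, qPochInf_self_ne_zero hq1, qPoch_sq_ne_zero hq1, h4,
    h2.summable, hs1, hs2⟩, ?_, h2.tsum_eq⟩
  have h5 := h3.tsum_eq
  rw [tsum_mul_left] at h5
  rw [mockPsi, h5]
  ring
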